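/- Let $A$ be a complex algebra (associative, not necessarily unital), let $H$ be a complex Hilbert space and let $\mathcal N$ be a maximal nest on $H$ which, ordered by inclusion, is order isomorphic to $\mathbb N\cup\{\infty\}$. (A nest is a chain of closed subspaces of $H$ that contains $\{0\}$ and $H$ and is closed under arbitrary intersections and arbitrary closed linear spans; it is maximal if it is not properly contained in another nest.) Let $\operatorname{Alg}\mathcal N$ be the algebra of all bounded operators $T$ on $H$ with $TM\subseteq M$ for every $M\in\mathcal N$, and let $\rho$ be a representation of $A$ on $H$, i.e. an algebra homomorphism $\rho:A\to B(H)$, such that $\rho(A)$ is contained in $\operatorname{Alg}\mathcal N$ and is dense in it in the w*-topology of $B(H)$ (the ultraweak topology, induced by the predual of trace class operators). Then the following are equivalent: (i) $\rho(A)$ contains a non-zero finite rank operator; (ii) $\ker\rho$ is not a prime ideal of $A$. Here an ideal means a two-sided algebra ideal, and an ideal $P\neq A$ is prime if, for all ideals $I,J$ of $A$, $IJ\subseteq P$ implies $I\subseteq P$ or $J\subseteq P$. -/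

import Mathlib

open scoped Topology

section NestAlgebras

variable {H : Type*} [NormedAddCommGroup H] [InnerProductSpace ℂ H]

/-- A nest on `H`: a chain of closed subspaces containing `{0}` and `H` that is complete, i.e.
closed under arbitrary intersections and arbitrary closed linear spans. -/
structure IsNest (N : Set (ClosedSubmodule ℂ H)) : Prop where
  isChain : IsChain (· ≤ ·) N
  bot_mem : ⊥ ∈ N
  top_mem : ⊤ ∈ N
  sInf_mem : ∀ S ⊆ N, sInf S ∈ N
  sSup_mem : ∀ S ⊆ N, sSup S ∈ N

/-- A maximal nest: a nest that is not properly contained in another nest. -/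
def IsMaximalNest (N : Set (ClosedSubmodule ℂ H)) : Prop :=
  Maximal IsNest N

/-- `Alg N`: the algebra of all bounded operators leaving every member of `N` invariant. -/
def algNest (N : Set (ClosedSubmodule ℂ H)) : Subalgebra ℂ (H →L[ℂ] H) where
  carrier := {T | ∀ M ∈ N, ∀ x ∈ M, T x ∈ M}
  mul_mem' hS hT M hM x hx := hS M hM _ (hT M hM x hx)
  add_mem' hS hT M hM x hx := add_mem (hS M hM x hx) (hT M hM x hx)
  algebraMap_mem' c M _ x hx := by
    have h : algebraMap ℂ (H →L[ℂ] H) c x = c • x := by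
      simp [Algebra.algebraMap_eq_smul_one]
    rw [h]
    exact SMulMemClass.smul_mem c hx

/-- The functional `T ↦ ∑ₙ ⟨yₙ, T xₙ⟩` (inner product linear in the second variable) given by
square-summable sequences `x`, `y` of vectors. On a Hilbert space these are exactly the functionals
`T ↦ tr (T K)` with `K` of trace class, i.e. the predual of `B(H)`. -/
noncomputable def weakStarFunctional (x y : lp (fun _ : ℕ => H) 2) (T : H →L[ℂ] H) : ℂ :=
  ∑' n, inner ℂ (y n) (T (x n))

/-- The series defining `weakStarFunctional` always converges absolutely. -/
theorem summable_weakStarFunctional (x y : lp (fun _ : ℕ => H) 2) (T : H →L[ℂ] H) :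
    Summable fun n => ‖inner ℂ (y n) (T (x n))‖ := by
  have hx : Summable fun n => ‖x n‖ ^ 2 := by
    simpa using (lp.memℓp x).summable (by norm_num)
  have hy : Summable fun n => ‖y n‖ ^ 2 := by
    simpa using (lp.memℓp y).summable (by norm_num)
  refine Summable.of_nonneg_of_le (fun n => norm_nonneg _) (fun n => ?_)
    ((hx.add hy).mul_left ‖T‖)
  calc ‖inner ℂ (y n) (T (x n))‖ ≤ ‖y n‖ * ‖T (x n)‖ := norm_inner_le_norm _ _
    _ ≤ ‖y n‖ * (‖T‖ * ‖x n‖) := by gcongr; exact T.le_opNorm _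
    _ = ‖T‖ * (‖y n‖ * ‖x n‖) := by ring
    _ ≤ ‖T‖ * (‖x n‖ ^ 2 + ‖y n‖ ^ 2) := by
      gcongr
      nlinarith [sq_nonneg (‖x n‖ - ‖y n‖), sq_nonneg (‖x n‖), sq_nonneg (‖y n‖)]

/-- The w*-topology (ultraweak topology) on `B(H)`: the coarsest topology for which all
functionals of the predual are continuous. -/
@[reducible]
noncomputable def weakStarTopology (H : Type*) [NormedAddCommGroup H] [InnerProductSpace ℂ H] :
    TopologicalSpace (H →L[ℂ] H) :=
  TopologicalSpace.induced
    (fun T (p : lp (fun _ : ℕ => H) 2 × lp (fun _ : ℕ => H) 2) => weakStarFunctional p.1 p.2 T)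
    Pi.topologicalSpace

/-- `S` is a w*-dense subset of `B`. -/
def IsWeakStarDenseIn (S B : Set (H →L[ℂ] H)) : Prop :=
  S ⊆ B ∧ B ⊆ closure[weakStarTopology H] S

end NestAlgebras

section Ideals

variable {A : Type*} [NonUnitalRing A] [Module ℂ A]

/-- Two-sided ideals of a complex algebra, not necessarily unital. -/
def IsAlgebraIdeal (I : Submodule ℂ A) : Prop :=
  ∀ a : A, ∀ x ∈ I, a * x ∈ I ∧ x * a ∈ I

/-- Prime ideals of a (noncommutative) complex algebra: proper two-sided ideals `P` such that
`I J ⊆ P` implies `I ⊆ P` or `J ⊆ P` for all two-sided ideals `I`, `J`. -/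
def IsPrimeAlgebraIdeal (P : Submodule ℂ A) : Prop :=
  IsAlgebraIdeal P ∧ P ≠ ⊤ ∧
    ∀ I J : Submodule ℂ A, IsAlgebraIdeal I → IsAlgebraIdeal J →
      (∀ x ∈ I, ∀ y ∈ J, x * y ∈ P) → I ≤ P ∨ J ≤ P

end Ideals

/-! Write E_n for `nestMember f n`. Maximality makes every E_n finite dimensional, and the E_n span
a dense subspace. If `ρ a` has finite rank, its range lies in some E_n
(`exists_forall_apply_mem_nestMember`). The elements acting as zero on E_n and those mapping H into
E_n form ideals I, J with IJ in the kernel. J contains `a`; I is not in the kernel because `ρ(A)` is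
infinite dimensional while its restriction to E_n is not. Conversely, if IJ lies in the kernel and i
∈ I, j ∈ J do not, then ρ(i) X ρ(j) = 0 for X in `ρ(A)`, hence by w*-density for all X in `Alg N`.
Testing on rank one X forces the range of ρ(j) into some E_n
(`finiteDimensional_range_of_mul_mul_eq_zero`). -/

section NestInsertion

variable {H : Type*} [NormedAddCommGroup H] [InnerProductSpace ℂ H]

/-- A closed subspace comparable to all members of a nest can be added to the nest. -/
theorem IsNest.insert {N : Set (ClosedSubmodule ℂ H)} (hN : IsNest N) {K : ClosedSubmodule ℂ H}
    (hK : ∀ M ∈ N, M ≤ K ∨ K ≤ M) : IsNest (insert K N) where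
  isChain := hN.isChain.insert fun M hM _ => (hK M hM).symm
  bot_mem := Set.mem_insert_of_mem _ hN.bot_mem
  top_mem := Set.mem_insert_of_mem _ hN.top_mem
  sInf_mem S hS := by
    by_cases hKS : K ∈ S
    -- `sInf S` is the smaller of `K` and `sInf (S ∩ N)`, which are comparable.
    · have hm : sInf (S ∩ N) ∈ N := hN.sInf_mem _ Set.inter_subset_right
      have hle : sInf S ≤ sInf (S ∩ N) := le_sInf fun M hM => sInf_le hM.1
      rcases hK _ hm with h | h
      · have heq : sInf S = sInf (S ∩ N) := by
          refine le_antisymm hle (le_sInf fun M hM => ?_)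
          rcases hS hM with rfl | hMN
          · exact h
          · exact sInf_le ⟨hM, hMN⟩
        exact heq ▸ Set.mem_insert_of_mem _ hm
      · have heq : sInf S = K := by
          refine le_antisymm (sInf_le hKS) (le_sInf fun M hM => ?_)
          rcases hS hM with rfl | hMN
          · exact le_rfl
          · exact h.trans (sInf_le ⟨hM, hMN⟩)
        exact heq ▸ Set.mem_insert _ _
    · exact Set.mem_insert_of_mem _ (hN.sInf_mem S fun M hM =>
        (hS hM).resolve_left fun h => hKS (h ▸ hM))
  sSup_mem S hS := by
    by_cases hKS : K ∈ S
    · have hm : sSup (S ∩ N) ∈ N := hN.sSup_mem _ Set.inter_subset_right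
      have hle : sSup (S ∩ N) ≤ sSup S := sSup_le fun M hM => le_sSup hM.1
      rcases hK _ hm with h | h
      · have heq : sSup S = K := by
          refine le_antisymm (sSup_le fun M hM => ?_) (le_sSup hKS)
          rcases hS hM with rfl | hMN
          · exact le_rfl
          · exact (le_sSup (show M ∈ S ∩ N from ⟨hM, hMN⟩)).trans h
        exact heq ▸ Set.mem_insert _ _
      · have heq : sSup S = sSup (S ∩ N) := by
          refine le_antisymm (sSup_le fun M hM => ?_) hle
          rcases hS hM with rfl | hMN
          · exact h
          · exact le_sSup ⟨hM, hMN⟩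
        exact heq ▸ Set.mem_insert_of_mem _ hm
    · exact Set.mem_insert_of_mem _ (hN.sSup_mem S fun M hM =>
        (hS hM).resolve_left fun h => hKS (h ▸ hM))

/-- A maximal nest contains every closed subspace comparable to all its members. -/
theorem IsMaximalNest.mem_of_comparable {N : Set (ClosedSubmodule ℂ H)} (hN : IsMaximalNest N)
    {K : ClosedSubmodule ℂ H} (hK : ∀ M ∈ N, M ≤ K ∨ K ≤ M) : K ∈ N :=
  hN.le_of_ge (hN.prop.insert hK) (Set.subset_insert K N) (Set.mem_insert K N)

end NestInsertion

/-! ### Maximal nests of order type `ℕ∞` -/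

section DiscreteNest

variable {H : Type*} [NormedAddCommGroup H] [InnerProductSpace ℂ H]
  {N : Set (ClosedSubmodule ℂ H)}

/-- The `n`-th member of a nest that is order isomorphic to `ℕ∞`. -/
noncomputable def nestMember (f : N ≃o ℕ∞) (n : ℕ) : ClosedSubmodule ℂ H :=
  (f.symm n : N)

theorem nestMember_mem (f : N ≃o ℕ∞) (n : ℕ) : nestMember f n ∈ N :=
  (f.symm n).2

theorem nestMember_strictMono (f : N ≃o ℕ∞) : StrictMono (nestMember f) := fun _ _ h =>
  f.symm.strictMono (Nat.cast_lt.2 h)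

theorem le_nestMember_or_nestMember_succ_le (f : N ≃o ℕ∞) (n : ℕ) {L : ClosedSubmodule ℂ H}
    (hL : L ∈ N) : L ≤ nestMember f n ∨ nestMember f (n + 1) ≤ L := by
  rcases le_or_gt (f ⟨L, hL⟩) n with h | h
  · left
    have h' : (⟨L, hL⟩ : N) ≤ f.symm n := f.le_symm_apply.2 h
    exact h'
  · right
    have h' : f.symm ((n + 1 : ℕ) : ℕ∞) ≤ (⟨L, hL⟩ : N) := by
      rw [f.symm_apply_le]
      push_cast
      exact Order.add_one_le_of_lt h
    exact h'

theorem nestMember_zero (hN : IsNest N) (f : N ≃o ℕ∞) : nestMember f 0 = ⊥ := by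
  have h : f.symm ((0 : ℕ) : ℕ∞) ≤ (⟨⊥, hN.bot_mem⟩ : N) := by
    rw [f.symm_apply_le]
    simp
  exact le_bot_iff.1 h

/-- A closed subspace containing all `nestMember f n` is everything. -/
theorem eq_top_of_forall_nestMember_le (hN : IsNest N) (f : N ≃o ℕ∞) {K : ClosedSubmodule ℂ H}
    (hK : ∀ n, nestMember f n ≤ K) : K = ⊤ := by
  have hmem : sSup (Set.range (nestMember f)) ∈ N :=
    hN.sSup_mem _ (Set.range_subset_iff.2 (nestMember_mem f))
  have hf : f ⟨_, hmem⟩ = ⊤ := by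
    refine ENat.eq_top_iff_forall_ge.2 fun n => ?_
    rw [← f.symm_apply_le]
    have hle : nestMember f n ≤ sSup (Set.range (nestMember f)) := le_sSup (Set.mem_range_self n)
    exact hle
  have htop : (⟨⊤, hN.top_mem⟩ : N) ≤ ⟨_, hmem⟩ := by
    rw [← f.le_iff_le, hf]
    exact le_top
  have htop' : ⊤ ≤ sSup (Set.range (nestMember f)) := htop
  exact top_le_iff.1 (htop'.trans (sSup_le (Set.forall_mem_range.2 hK)))

/-- The members of finite index of a maximal nest of order type `ℕ∞` are finite dimensional. -/
theorem finiteDimensional_nestMember (hN : IsMaximalNest N) (f : N ≃o ℕ∞) (n : ℕ) :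
    FiniteDimensional ℂ (nestMember f n).toSubmodule := by
  induction n with
  | zero =>
    rw [nestMember_zero hN.prop]
    simp only [ClosedSubmodule.toSubmodule_bot]
    infer_instance
  | succ n ih =>
    have hlt := nestMember_strictMono f n.lt_succ_self
    obtain ⟨z, hz, hzn⟩ := SetLike.exists_of_lt hlt
    -- Nothing in the nest lies strictly between E_n and E_{n+1}, so `V` is in the nest by
    -- maximality and must equal E_{n+1}.
    set V : Submodule ℂ H := (nestMember f n).toSubmodule ⊔ ℂ ∙ z with hV
    have hfin : FiniteDimensional ℂ V := by rw [hV]; infer_instance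
    let K : ClosedSubmodule ℂ H := ⟨V, V.closed_of_finiteDimensional⟩
    have hnK : nestMember f n ≤ K := fun x hx => Submodule.mem_sup_left hx
    have hKn : K ≤ nestMember f (n + 1) := by
      have h : V ≤ (nestMember f (n + 1)).toSubmodule :=
        sup_le hlt.le ((Submodule.span_singleton_le_iff_mem _ _).2 hz)
      exact h
    have hzK : z ∈ K := Submodule.mem_sup_right (Submodule.mem_span_singleton_self z)
    have hKN : K ∈ N := hN.mem_of_comparable fun M hM =>
      (le_nestMember_or_nestMember_succ_le f n hM).imp (·.trans hnK) hKn.trans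
    have hle : nestMember f (n + 1) ≤ K :=
      (le_nestMember_or_nestMember_succ_le f n hKN).resolve_left fun h => hzn (h hzK)
    exact Submodule.finiteDimensional_of_le
      (show (nestMember f (n + 1)).toSubmodule ≤ V from hle)

theorem not_finiteDimensional_of_nest (f : N ≃o ℕ∞) : ¬ FiniteDimensional ℂ H := fun _ =>
  not_strictMono_of_wellFoundedGT (fun n => (nestMember f n).toSubmodule) fun _ _ h =>
    nestMember_strictMono f h

/-- A rank one operator `x ⊗ y*` with `x` in a member of the nest whose predecessor is orthogonal
to `y` lies in the nest algebra. -/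
theorem rankOne_mem_algNest (f : N ≃o ℕ∞) {n : ℕ} {x y : H} (hx : x ∈ nestMember f (n + 1))
    (hy : ∀ z ∈ nestMember f n, inner ℂ y z = 0) :
    InnerProductSpace.rankOne ℂ x y ∈ algNest N := by
  intro M hM z hz
  rw [InnerProductSpace.rankOne_apply]
  rcases le_nestMember_or_nestMember_succ_le f n hM with h | h
  · rw [hy z (h hz), zero_smul]
    exact zero_mem M
  · exact SMulMemClass.smul_mem _ (h hx)

/-- The range of a finite rank operator in the algebra of a nest of order type `ℕ∞` is contained in
a member of finite index. -/
theorem exists_forall_apply_mem_nestMember (hN : IsNest N) (f : N ≃o ℕ∞) {T : H →L[ℂ] H}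
    (hT : T ∈ algNest N) (hfin : FiniteDimensional ℂ (LinearMap.range (T : H →ₗ[ℂ] H))) :
    ∃ n, ∀ x, T x ∈ nestMember f n := by
  let R := LinearMap.range (T : H →ₗ[ℂ] H)
  let T' : H →ₗ[ℂ] R := (T : H →ₗ[ℂ] H).rangeRestrict
  let c : ℕ →o Submodule ℂ R :=
    ⟨fun n => (nestMember f n).toSubmodule.map T', fun _ _ h =>
      Submodule.map_mono ((nestMember_strictMono f).monotone h)⟩
  obtain ⟨n, hn⟩ := monotone_stabilizes_iff_noetherian.2 inferInstance c
  refine ⟨n, fun x => ?_⟩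
  -- Since the images T(E_m) stabilize at `n`, the closed preimage of E_n contains every E_m.
  have htop : (nestMember f n).comap T = ⊤ := by
    have hV : FiniteDimensional ℂ ((nestMember f n).toSubmodule.map (T : H →ₗ[ℂ] H)) :=
      Submodule.finiteDimensional_of_le (LinearMap.map_le_range)
    refine eq_top_of_forall_nestMember_le hN f fun m z hz => ?_
    rcases le_total m n with h | h
    · exact hT _ (nestMember_mem f n) z ((nestMember_strictMono f).monotone h hz)
    · have hmem : T' z ∈ c n := by
        rw [hn m h]
        exact Submodule.mem_map_of_mem hz
      obtain ⟨w, hw, hwz⟩ := hmem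
      have hwz' : T w = T z := congrArg Subtype.val hwz
      rw [ClosedSubmodule.mem_comap, ← hwz']
      exact hT _ (nestMember_mem f n) w hw
  exact ClosedSubmodule.mem_comap.1 (htop ▸ ClosedSubmodule.mem_top)

end DiscreteNest

/-! ### Passing to w*-closures -/

section WeakStar

variable {H : Type*} [NormedAddCommGroup H] [InnerProductSpace ℂ H]

theorem weakStarFunctional_single (u v : H) (T : H →L[ℂ] H) :
    weakStarFunctional (lp.single 2 0 v) (lp.single 2 0 u) T = inner ℂ u (T v) := by
  rw [weakStarFunctional, tsum_eq_single 0]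
  · simp
  · intro n hn
    simp [hn]

theorem continuous_inner_apply (u v : H) :
    @Continuous _ _ (weakStarTopology H) _ fun T : H →L[ℂ] H => inner ℂ u (T v) := by
  let _ := weakStarTopology H
  have h : Continuous fun (T : H →L[ℂ] H)
      (p : lp (fun _ : ℕ => H) 2 × lp (fun _ : ℕ => H) 2) => weakStarFunctional p.1 p.2 T :=
    continuous_induced_dom
  have h' := continuous_pi_iff.1 h (lp.single 2 0 v, lp.single 2 0 u)
  simp only [weakStarFunctional_single] at h'
  exact h'

/-- A matrix coefficient vanishing on a w*-dense subset vanishes identically. -/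
theorem IsWeakStarDenseIn.inner_apply_eq_zero {S B : Set (H →L[ℂ] H)}
    (h : IsWeakStarDenseIn S B) {u v : H} (hS : ∀ T ∈ S, inner ℂ u (T v) = 0) {T : H →L[ℂ] H}
    (hT : T ∈ B) : inner ℂ u (T v) = 0 := by
  let _ := weakStarTopology H
  have hcl : IsClosed {T : H →L[ℂ] H | inner ℂ u (T v) = 0} :=
    isClosed_singleton.preimage (continuous_inner_apply u v)
  exact closure_minimal hS hcl (h.2 hT)

/-- `T X S = 0` for all `X` in a w*-dense subset implies `T X S = 0` for all `X`. -/
theorem IsWeakStarDenseIn.apply_apply_apply_eq_zero [CompleteSpace H] {S B : Set (H →L[ℂ] H)}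
    (h : IsWeakStarDenseIn S B) {T R : H →L[ℂ] H} (hS : ∀ X ∈ S, ∀ v, T (X (R v)) = 0)
    {X : H →L[ℂ] H} (hX : X ∈ B) (v : H) : T (X (R v)) = 0 := by
  refine ext_inner_left ℂ fun u => ?_
  rw [inner_zero_right, ← ContinuousLinearMap.adjoint_inner_left]
  refine h.inner_apply_eq_zero (fun Y hY => ?_) hX
  rw [ContinuousLinearMap.adjoint_inner_left, hS Y hY, inner_zero_right]

end WeakStar

/-! ### W*-dense subspaces of the nest algebra -/

section DenseSubalgebras

variable {H : Type*} [NormedAddCommGroup H] [InnerProductSpace ℂ H]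
  {N : Set (ClosedSubmodule ℂ H)}

/-- The matrix coefficients `⟨x, · y⟩` of a w*-dense subset of the nest algebra, for a fixed
non-zero `x` in the first non-zero member, separate the vectors `y`. -/
theorem eq_zero_of_forall_inner_apply_eq_zero (hN : IsNest N) (f : N ≃o ℕ∞)
    {S : Set (H →L[ℂ] H)} (hS : IsWeakStarDenseIn S (algNest N)) {x y : H}
    (hx : x ∈ nestMember f 1) (hx0 : x ≠ 0) (h : ∀ T ∈ S, inner ℂ x (T y) = 0) : y = 0 := by
  have hmem : InnerProductSpace.rankOne ℂ x y ∈ algNest N :=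
    -- As E_0 = 0, orthogonality is vacuous and every `y` is allowed.
    rankOne_mem_algNest f (n := 0) hx fun z hz => by
      rw [nestMember_zero hN, ClosedSubmodule.mem_bot] at hz
      rw [hz, inner_zero_right]
  have h0 := hS.inner_apply_eq_zero h hmem
  rw [InnerProductSpace.rankOne_apply, inner_smul_right, mul_eq_zero] at h0
  simpa [hx0] using h0

theorem exists_mem_nestMember_one_ne_zero (f : N ≃o ℕ∞) :
    ∃ x ∈ nestMember f 1, x ≠ 0 := by
  obtain ⟨x, hx, hx0⟩ := SetLike.exists_of_lt (nestMember_strictMono f zero_lt_one)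
  refine ⟨x, hx, fun h => hx0 (h ▸ zero_mem _)⟩

/-- A w*-dense subspace of the nest algebra is infinite dimensional. -/
theorem not_finiteDimensional_of_dense (hN : IsNest N) (f : N ≃o ℕ∞)
    {B : Submodule ℂ (H →L[ℂ] H)} (hB : IsWeakStarDenseIn (B : Set (H →L[ℂ] H)) (algNest N)) :
    ¬ FiniteDimensional ℂ B := by
  intro _
  obtain ⟨x, hx, hx0⟩ := exists_mem_nestMember_one_ne_zero f
  -- Separation of vectors embeds H into the dual of `B`.
  let Φ : H →ₗ[ℂ] Module.Dual ℂ B :=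
    LinearMap.mk₂ ℂ (fun (y : H) (T : B) => inner ℂ x ((T : H →L[ℂ] H) y))
      (fun _ _ _ => by rw [map_add, inner_add_right])
      (fun _ _ _ => by rw [map_smul, inner_smul_right, smul_eq_mul])
      (fun _ _ _ => inner_add_right _ _ _) (fun _ _ _ => inner_smul_right _ _ _)
  have hΦ : Function.Injective Φ := by
    rw [injective_iff_map_eq_zero]
    refine fun y hy => eq_zero_of_forall_inner_apply_eq_zero hN f hB hx hx0 fun T hT => ?_
    exact LinearMap.congr_fun hy ⟨T, hT⟩
  exact not_finiteDimensional_of_nest f (FiniteDimensional.of_injective Φ hΦ)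

/-- A w*-dense subspace of the nest algebra contains a non-zero operator that vanishes on
`nestMember f n`. -/
theorem exists_mem_ne_zero_forall_nestMember_apply_eq_zero (hN : IsMaximalNest N) (f : N ≃o ℕ∞)
    {B : Submodule ℂ (H →L[ℂ] H)} (hB : IsWeakStarDenseIn (B : Set (H →L[ℂ] H)) (algNest N))
    (n : ℕ) : ∃ T ∈ B, T ≠ 0 ∧ ∀ x ∈ nestMember f n, T x = 0 := by
  by_contra! hcon
  let M := (nestMember f n).toSubmodule
  have : FiniteDimensional ℂ M := finiteDimensional_nestMember hN f n
  let Ψ : B →ₗ[ℂ] M →ₗ[ℂ] M :=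
    { toFun T := (T.1 : H →ₗ[ℂ] H).restrict (p := M) (q := M) (hB.1 T.2 _ (nestMember_mem f n))
      map_add' _ _ := rfl
      map_smul' _ _ := rfl }
  have hΨ : Function.Injective Ψ := by
    rw [injective_iff_map_eq_zero]
    rintro ⟨T, hT⟩ h
    by_contra hT0
    obtain ⟨x, hx, hx0⟩ := hcon T hT fun h => hT0 (Subtype.ext h)
    exact hx0 (congrArg Subtype.val (LinearMap.congr_fun h ⟨x, hx⟩))
  exact not_finiteDimensional_of_dense hN.prop f hB (FiniteDimensional.of_injective Ψ hΨ)

/-- If `T X S = 0` for all `X` in the algebra of a maximal nest of order type `ℕ∞` and `T ≠ 0`,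
then `S` has finite rank. -/
theorem finiteDimensional_range_of_mul_mul_eq_zero [CompleteSpace H] (hN : IsMaximalNest N)
    (f : N ≃o ℕ∞) {T S : H →L[ℂ] H} (hT : T ≠ 0)
    (h : ∀ X ∈ algNest N, ∀ v, T (X (S v)) = 0) :
    FiniteDimensional ℂ (LinearMap.range (S : H →ₗ[ℂ] H)) := by
  obtain ⟨n, x, hx, hTx⟩ : ∃ n, ∃ x ∈ nestMember f n, T x ≠ 0 := by
    by_contra! hcon
    have htop : (⊥ : ClosedSubmodule ℂ H).comap T = ⊤ :=
      eq_top_of_forall_nestMember_le hN.prop f fun n x hx => hcon n x hx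
    refine hT (ContinuousLinearMap.ext fun x => ?_)
    have hx : x ∈ (⊥ : ClosedSubmodule ℂ H).comap T := htop ▸ ClosedSubmodule.mem_top
    exact hx
  have := finiteDimensional_nestMember hN f n
  suffices hS : LinearMap.range (S : H →ₗ[ℂ] H) ≤ (nestMember f n).toSubmodule from
    Submodule.finiteDimensional_of_le hS
  rintro _ ⟨v, rfl⟩
  -- For `y` orthogonal to E_n, the operator x ⊗ y* gives ⟨y, S v⟩ T x = 0, with T x ≠ 0.
  rw [← Submodule.orthogonal_orthogonal (nestMember f n).toSubmodule, Submodule.mem_orthogonal]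
  intro y hy
  have hmem : InnerProductSpace.rankOne ℂ x y ∈ algNest N :=
    rankOne_mem_algNest f (nestMember_strictMono f n.lt_succ_self |>.le hx) fun z hz =>
      (Submodule.mem_orthogonal' _ _).1 hy z hz
  have h0 := h _ hmem v
  rw [InnerProductSpace.rankOne_apply, map_smul, smul_eq_zero] at h0
  exact h0.resolve_right hTx

end DenseSubalgebras

theorem theorem3p3
    {A : Type*} [NonUnitalRing A] [Module ℂ A] [IsScalarTower ℂ A A] [SMulCommClass ℂ A A]
    {H : Type*} [NormedAddCommGroup H] [InnerProductSpace ℂ H] [CompleteSpace H]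
    (N : Set (ClosedSubmodule ℂ H)) (hN : IsMaximalNest N) (hord : Nonempty (N ≃o ℕ∞))
    (ρ : A →ₙₐ[ℂ] (H →L[ℂ] H))
    (hρ : IsWeakStarDenseIn (Set.range ρ) (algNest N : Set (H →L[ℂ] H))) :
    (∃ T ∈ Set.range ρ, T ≠ 0 ∧ FiniteDimensional ℂ (LinearMap.range (T : H →ₗ[ℂ] H))) ↔
      ¬ IsPrimeAlgebraIdeal (LinearMap.ker (ρ : A →ₗ[ℂ] (H →L[ℂ] H))) := by
  obtain ⟨f⟩ := hord
  have hker (a : A) : a ∈ LinearMap.ker (ρ : A →ₗ[ℂ] (H →L[ℂ] H)) ↔ ρ a = 0 := Iff.rfl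
  have hB : IsWeakStarDenseIn
      (LinearMap.range (ρ : A →ₗ[ℂ] (H →L[ℂ] H)) : Set (H →L[ℂ] H)) (algNest N) := hρ
  constructor
  · rintro ⟨_, ⟨a, rfl⟩, ha0, hfin⟩ ⟨-, -, hprime⟩
    obtain ⟨n, hn⟩ := exists_forall_apply_mem_nestMember hN.prop f (hρ.1 ⟨a, rfl⟩) hfin
    obtain ⟨_, ⟨b, rfl⟩, hb0, hb⟩ :=
      exists_mem_ne_zero_forall_nestMember_apply_eq_zero hN f hB n
    let I : Submodule ℂ A :=
      { carrier := {a | ∀ x ∈ nestMember f n, ρ a x = 0}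
        add_mem' ha hb x hx := by simp [ha x hx, hb x hx]
        zero_mem' x _ := by simp
        smul_mem' c a ha x hx := by simp [ha x hx] }
    let J : Submodule ℂ A :=
      { carrier := {a | ∀ x, ρ a x ∈ nestMember f n}
        add_mem' ha hb x := by simpa using add_mem (ha x) (hb x)
        zero_mem' x := by simp
        smul_mem' c a ha x := by simpa using SMulMemClass.smul_mem c (ha x) }
    have hinv (a : A) (x : H) (hx : x ∈ nestMember f n) : ρ a x ∈ nestMember f n :=
      hρ.1 ⟨a, rfl⟩ _ (nestMember_mem f n) x hx
    have hI : IsAlgebraIdeal I := fun a i hi => by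
      refine ⟨fun x hx => ?_, fun x hx => ?_⟩
      · simp [hi x hx]
      · simpa using hi _ (hinv a x hx)
    have hJ : IsAlgebraIdeal J := fun a j hj => by
      refine ⟨fun x => ?_, fun x => ?_⟩
      · simpa using hinv a _ (hj x)
      · simpa using hj (ρ a x)
    have hIJ : ∀ i ∈ I, ∀ j ∈ J, i * j ∈ LinearMap.ker (ρ : A →ₗ[ℂ] (H →L[ℂ] H)) := by
      intro i hi j hj
      rw [hker]
      ext x
      simpa using hi _ (hj x)
    rcases hprime I J hI hJ hIJ with h | h
    · exact hb0 (h (show b ∈ I from hb))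
    · exact ha0 (h (show a ∈ J from hn))
  · intro hprime
    have hideal : IsAlgebraIdeal (LinearMap.ker (ρ : A →ₗ[ℂ] (H →L[ℂ] H))) := fun a x hx => by
      rw [hker] at hx
      simp [hker, hx]
    have hproper : LinearMap.ker (ρ : A →ₗ[ℂ] (H →L[ℂ] H)) ≠ ⊤ := by
      intro htop
      obtain ⟨_, ⟨a, rfl⟩, ha0, -⟩ :=
        -- Only a non-zero operator in `ρ(A)` is needed; the index 0 is arbitrary.
        exists_mem_ne_zero_forall_nestMember_apply_eq_zero hN f hB 0
      exact ha0 (LinearMap.mem_ker.1 (htop ▸ Submodule.mem_top))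
    rw [IsPrimeAlgebraIdeal, not_and] at hprime
    have hprime := not_and.1 (hprime hideal) hproper
    push Not at hprime
    obtain ⟨I, J, hI, -, hIJ, hIP, hJP⟩ := hprime
    obtain ⟨i, hi, hi0⟩ := SetLike.not_le_iff_exists.1 hIP
    obtain ⟨j, hj, hj0⟩ := SetLike.not_le_iff_exists.1 hJP
    refine ⟨ρ j, ⟨j, rfl⟩, hj0, ?_⟩
    refine finiteDimensional_range_of_mul_mul_eq_zero hN f (T := ρ i) hi0 fun X hX v => ?_
    refine hρ.apply_apply_apply_eq_zero ?_ hX v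
    rintro _ ⟨a, rfl⟩ w
    -- The middle factor is absorbed into I: (i a) j lies in IJ.
    have h := (hker _).1 (hIJ _ (hI a i hi).2 j hj)
    simpa using congrArg (fun T : H →L[ℂ] H => T w) h
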